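/- **Theorem (Existence of an optimal stationary policy).** Let $\mathcal Z=\{\mathrm{LL},\mathrm{LH},\mathrm{HL},\mathrm{HH}\}$ be the set of regimes, $d\ge 0$ the number of risky assets, $\mathcal X$ a standard Borel space and $\mathcal Y$ a Polish space (either of $\mathcal X,\mathcal Y$ may be a single point). Let $\mathcal W\subset\mathbb R^d$ be nonempty, convex and compact (feasible post-trade weights), and let $\mathcal H\subset\mathbb R^d$ be convex and Borel (admissible pre-trade weights; e.g. $\mathcal H=\mathcal W$). A state is $s=(x,y,w,z)\in\mathcal S:=\mathcal X\times\mathcal Y\times\mathcal H\times\mathcal Z$ (predictors $(x,y)$, pre-trade weights $w$, regime $z$), and an action is $a\in\mathcal W$. Given $(s,a)$, the next state $s'=(x',y',w',z')$ and the vector $\rho\in\mathbb R^d$ of next-period asset returns have joint law $P(\cdot\mid s,a)$, where $P$ is a Markov kernel. The after-cost reward is $$r^{\mathrm{net}}(s,a,\rho)=a^\top\rho-C_z(a-w)-\lambda\,\Psi(L),\qquad L=-a^\top\rho .$$ Assume: 1. for each $z$, the cost $C_z$ is real-valued, convex and lower semicontinuous on the set $\mathcal W-\mathcal H$ of possible trades,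 $C_z(0)=0$, and there is $\kappa_1(z)>0$ with $C_z(u)\ge\kappa_1(z)\|u\|_1$ for all $u\in\mathcal W-\mathcal H$; 2. $\Psi:\mathbb R\to[0,\infty)$ is Lipschitz on compact sets, and $\lambda\ge0$; 3. there is $\bar r$ such that for all $(s,a)$, $|r^{\mathrm{net}}(s,a,\rho)|\le\bar r$ holds $P(\cdot\mid s,a)$-almost surely; 4. (continuity of the environment) for every bounded measurable $f:\mathcal S\times\mathbb R^d\to\mathbb R$ such that $f((x',y',w',z'),\rho)$ is continuous in $(y',w',\rho)$ for all $x',z'$, and for all $x,z$, the map $(y,w,a)\mapsto\int f\,dP(\cdot\mid (x,y,w,z),a)$ is continuous on $\mathcal Y\times\mathcal H\times\mathcal W$; 5. $0\le\gamma<1$. For a history-dependent randomized policy $\pi$ and an initial law $\mu_0$ on $\mathcal S$ let $J(\mu_0,\pi)=\mathbb E^\pi_{\mu_0}\big[\sum_{t\ge0}\gamma^t r^{\mathrm{net}}(s_t,a_t,\rho_{t+1})\big]$ and $V^\pi(s)=J(\delta_s,\pi)$, and for stationary $\pi$ let $Q^\pi(s,a)=\int\big(r^{\mathrm{net}}(s,a,\rho)+\gamma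 V^\pi(s')\big)\,P(d(s',\rho)\mid s,a)$. Then there is a stationary Markov policy $\pi^\star$ that is optimal: $J(\mu_0,\pi)\le J(\mu_0,\pi^\star)$ for every probability measure $\mu_0$ on $\mathcal S$ and every history-dependent randomized policy $\pi$. Moreover $\pi^\star$ can be taken deterministic, given by a measurable map $\varphi:\mathcal S\to\mathcal W$ with $\varphi(s)\in\arg\max_{a\in\mathcal W}Q^{\pi^\star}(s,a)$ for every $s\in\mathcal S$. -/

import Mathlib

open MeasureTheory ProbabilityTheory Set
open scoped Pointwise

noncomputable section

/-- The four observed market regimes: (low/high) volatility times (low/high) illiquidity. -/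
inductive Regime : Type where
  | LL : Regime
  | LH : Regime
  | HL : Regime
  | HH : Regime

instance : MeasurableSpace Regime := ⊤

/-- The vectors of `d` portfolio weights, trades or asset returns. -/
abbrev Weights (d : ℕ) : Type := EuclideanSpace ℝ (Fin d)

/-- The data of a regime-augmented frictional portfolio MDP with `d` risky assets.

A state is `(x, y, w, z)`: predictors `(x, y)`, pre-trade weights `w ∈ holdings`, regime `z`.
An action is a vector `a ∈ actions` of post-trade target weights. Given the state and the action,
`kernel` is the joint law of the next state and of the next-period asset returns. The predictor
`y` is topological and `x` is only measurable; either of the two may be a one-point space. -/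
structure PortfolioMDP (X Y : Type*) [MeasurableSpace X] [MeasurableSpace Y] (d : ℕ) where
  /-- the feasible set of post-trade weights -/
  actions : Set (Weights d)
  /-- the set of admissible pre-trade weights -/
  holdings : Set (Weights d)
  /-- the environment: joint law of next state and next-period asset returns -/
  kernel : Kernel ((X × Y × holdings × Regime) × actions)
    ((X × Y × holdings × Regime) × Weights d)
  isMarkovKernel : IsMarkovKernel kernel
  /-- the execution cost of a trade in each regime -/
  cost : Regime → Weights d → ℝ
  /-- the downside-risk proxy, a function of the realised portfolio loss -/
  riskProxy : ℝ → ℝ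
  /-- the weight of the downside-risk proxy in the reward -/
  riskWeight : ℝ
  /-- the discount factor -/
  discount : ℝ

namespace PortfolioMDP

variable {X Y : Type*} [MeasurableSpace X] [MeasurableSpace Y] {d : ℕ}

attribute [instance] PortfolioMDP.isMarkovKernel

/-- States `(x, y, w, z)`. -/
abbrev State (M : PortfolioMDP X Y d) : Type _ := X × Y × M.holdings × Regime

/-- Actions: feasible post-trade weights. -/
abbrev Action (M : PortfolioMDP X Y d) : Type _ := M.actions

/-- What is observed at a decision epoch: the current state and the asset returns realised over
the period that has just ended. -/
abbrev Obs (M : PortfolioMDP X Y d) : Type _ := M.State × Weights d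

/-- The record of one decision epoch: what is observed, and the action then chosen. -/
abbrev Epoch (M : PortfolioMDP X Y d) : Type _ := M.Obs × M.Action

/-- The portfolio return `a ⬝ ρ` of the weights `a` when the asset returns are `ρ`. -/
def grossReturn (a ρ : Weights d) : ℝ := ∑ i, a i * ρ i

/-- The realised after-cost reward `a ⬝ ρ - C_z(a - w) - λ Ψ(L)` of action `a` in state
`(x, y, w, z)` when the next-period asset returns are `ρ`; the portfolio loss is `L = -(a ⬝ ρ)`. -/
def netReward (M : PortfolioMDP X Y d) (s : M.State) (a : M.Action) (ρ : Weights d) : ℝ :=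
  grossReturn (a : Weights d) ρ
    - M.cost s.2.2.2 ((a : Weights d) - (s.2.2.1 : Weights d))
    - M.riskWeight * M.riskProxy (-grossReturn (a : Weights d) ρ)

/-- A history-dependent randomized policy: at time `0` the action is drawn given the initial
state; at time `n + 1` it is drawn given all observations and actions up to time `n` and the
observation at time `n + 1`. -/
structure Policy (M : PortfolioMDP X Y d) where
  init : Kernel M.State M.Action
  init_markov : IsMarkovKernel init
  step : (n : ℕ) → Kernel ((Finset.Iic n → M.Epoch) × M.Obs) M.Action
  step_markov : ∀ n, IsMarkovKernel (step n)

attribute [instance] Policy.init_markov Policy.step_markov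

/-- The stationary Markov policy that draws its action from `σ` given the current state. -/
def stationary (M : PortfolioMDP X Y d) (σ : Kernel M.State M.Action) [IsMarkovKernel σ] :
    M.Policy where
  init := σ
  init_markov := inferInstance
  step _ := σ.comap (fun p => p.2.1) (by fun_prop)
  step_markov _ := inferInstance

/-- The law of the epoch at time `n + 1` given the epochs up to time `n`: the environment draws
state and returns given the last state and action, then the policy draws an action. -/
def epochKernel (M : PortfolioMDP X Y d) (π : M.Policy) (n : ℕ) :
    Kernel (Finset.Iic n → M.Epoch) M.Epoch :=
  (M.kernel.comap
    (fun h => ((h ⟨n, Finset.mem_Iic.2 le_rfl⟩).1.1, (h ⟨n, Finset.mem_Iic.2 le_rfl⟩).2))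
    (by fun_prop)).compProd (π.step n)

instance (M : PortfolioMDP X Y d) (π : M.Policy) (n : ℕ) : IsMarkovKernel (M.epochKernel π n) := by
  unfold epochKernel; infer_instance

/-- The law of the epoch at time `0` when the initial state has law `μ₀`. No returns have been
realised yet, and that entry is set to `0`. -/
def initialLaw (M : PortfolioMDP X Y d) (μ₀ : Measure M.State) (π : M.Policy) :
    Measure M.Epoch :=
  (μ₀.compProd π.init).map (fun p => ((p.1, 0), p.2))

/-- The law of the controlled process with initial state law `μ₀` under the policy `π`. -/
def pathLaw (M : PortfolioMDP X Y d) (μ₀ : Measure M.State) (π : M.Policy) :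
    Measure (ℕ → M.Epoch) :=
  Kernel.trajMeasure (X := fun _ => M.Epoch) (M.initialLaw μ₀ π) (M.epochKernel π)

/-- The discounted after-cost reward `∑ₜ γ ^ t * r_t` along a path. -/
def discountedReward (M : PortfolioMDP X Y d) (ω : ℕ → M.Epoch) : ℝ :=
  ∑' t : ℕ, M.discount ^ t * M.netReward (ω t).1.1 (ω t).2 (ω (t + 1)).1.2

/-- The objective: expected discounted after-cost reward. -/
def objective (M : PortfolioMDP X Y d) (μ₀ : Measure M.State) (π : M.Policy) : ℝ :=
  ∫ ω, M.discountedReward ω ∂(M.pathLaw μ₀ π)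

/-- The value `V^π(s)`. -/
def value (M : PortfolioMDP X Y d) (π : M.Policy) (s : M.State) : ℝ :=
  M.objective (Measure.dirac s) π

/-- The action value `Q^π(s, a) = E[r + γ V^π(s') | s, a]`, for a stationary policy `π`. -/
def actionValue (M : PortfolioMDP X Y d) (π : M.Policy) (s : M.State) (a : M.Action) : ℝ :=
  ∫ o, (M.netReward s a o.2 + M.discount * M.value π o.1) ∂(M.kernel (s, a))

/-- `π` maximizes the objective over all history-dependent randomized policies, for every law of
the initial state. -/
def IsOptimal (M : PortfolioMDP X Y d) (π : M.Policy) : Prop :=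
  ∀ μ₀ : Measure M.State, IsProbabilityMeasure μ₀ →
    ∀ π' : M.Policy, M.objective μ₀ π' ≤ M.objective μ₀ π

/-- Continuity of the environment: for all `x, z`, the expectation of `f(x', y', w', z', ρ)` is
jointly continuous in `(y, w, a)`, for each bounded measurable `f` that is continuous in
`(y', w', ρ)`. -/
def ContinuousEnvironment [TopologicalSpace Y] (M : PortfolioMDP X Y d) : Prop :=
  ∀ f : M.Obs → ℝ, Measurable f → (∃ B : ℝ, ∀ o, |f o| ≤ B) →
    (∀ x z, Continuous fun p : Y × M.holdings × Weights d => f ((x, p.1, p.2.1, z), p.2.2)) →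
    ∀ x z, Continuous fun p : Y × M.holdings × M.Action =>
      ∫ o, f o ∂(M.kernel ((x, p.1, p.2.1, z), p.2.2))

/-- The standing assumptions on the portfolio MDP. The cost is constrained on the set
`actions - holdings` of trades that can occur. -/
structure Regular [TopologicalSpace Y] (M : PortfolioMDP X Y d) : Prop where
  actions_nonempty : M.actions.Nonempty
  actions_convex : Convex ℝ M.actions
  actions_compact : IsCompact M.actions
  holdings_convex : Convex ℝ M.holdings
  holdings_measurable : MeasurableSet M.holdings
  cost_convex : ∀ z, ConvexOn ℝ (M.actions - M.holdings) (M.cost z)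
  cost_lsc : ∀ z, LowerSemicontinuousOn (M.cost z) (M.actions - M.holdings)
  cost_zero : ∀ z, M.cost z 0 = 0
  cost_lower : ∀ z, ∃ κ : ℝ, 0 < κ ∧ ∀ u ∈ M.actions - M.holdings, κ * ∑ i, |u i| ≤ M.cost z u
  riskProxy_nonneg : ∀ l, 0 ≤ M.riskProxy l
  riskProxy_lipschitz : ∀ K : Set ℝ, IsCompact K → ∃ L, LipschitzOnWith L M.riskProxy K
  riskWeight_nonneg : 0 ≤ M.riskWeight
  discount_nonneg : 0 ≤ M.discount
  discount_lt_one : M.discount < 1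
  reward_bounded : ∃ r : ℝ, ∀ s a, ∀ᵐ o ∂(M.kernel (s, a)), |M.netReward s a o.2| ≤ r
  continuousEnvironment : M.ContinuousEnvironment

end PortfolioMDP

end

/-! Dynamic programming proves the theorem once the optimality equation `V s = max_a bellman V s a`
has a bounded measurable solution with a measurable maximizer. Two obstacles stand in the way. The
reward is only upper semicontinuous (the cost is only lower semicontinuous) and only almost surely
bounded, while the continuity hypothesis on the environment tests bounded functions continuous in
`(y', w', ρ)`. Moreover, nothing is continuous in `x`.

Both are met by approximation from above. The reward truncated to `[-R, R]` is the limit of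
decreasing Lipschitz functions `r n`. Value iteration that uses `r n` in step `n` and starts at the
constant `R / (1 - γ)` gives decreasing iterates, measurable and continuous in `(y, w)`. Let `V` be
their limit. By dominated convergence the one-step returns decrease to `bellman V`, where truncation
has no effect. Their superlevel sets in the compact action space are nested, so a common point
exists: limit and supremum commute and the maximum is attained
(`Regular.exists_optimality_equation`). The maximizer is made measurable by parametrizing the
actions by the Cantor set and taking the least admissible parameter (`exists_measurable_forall_le`).

Verification telescopes `E[r + γ V(s')]` along the path law. The inequality `bellman V ≤ V` bounds
every history-dependent policy by `∫ V`, and equality along `φ` attains this bound. Hence `V` is the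
value of the selected policy and `bellman V` is its action value. -/

open Filter Topology

noncomputable section

/-! ### Semicontinuous approximation, compactness and measurable selection -/

/-- A bounded upper semicontinuous function on a metric space is the limit of a decreasing
sequence of bounded Lipschitz functions. -/
theorem UpperSemicontinuous.exists_antitone_lipschitz_tendsto {E : Type*} [PseudoMetricSpace E]
    {f : E → ℝ} (hf : UpperSemicontinuous f) {B : ℝ} (hB : ∀ e, |f e| ≤ B) :
    ∃ g : ℕ → E → ℝ, (∀ n : ℕ, LipschitzWith n (g n)) ∧ (∀ n e, |g n e| ≤ B) ∧
      Antitone g ∧ ∀ e, Tendsto (fun n => g n e) atTop (𝓝 (f e)) := by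
  have hle : ∀ (n : ℕ) (e e' : E), f e' - n * dist e e' ≤ B := fun n e e' => by
    have h1 := (abs_le.1 (hB e')).2
    have h2 : 0 ≤ (n : ℝ) * dist e e' := by positivity
    linarith
  have hbdd : ∀ (n : ℕ) (e : E), BddAbove (range fun e' => f e' - n * dist e e') := fun n e =>
    ⟨B, by rintro _ ⟨e', rfl⟩; exact hle n e e'⟩
  have hge : ∀ (n : ℕ) (e : E), f e ≤ ⨆ e', (f e' - n * dist e e') := fun n e => by
    simpa using le_ciSup (hbdd n e) e
  -- Sup-convolution with the cone of slope `n`: `n`-Lipschitz as a supremum of `n`-Lipschitz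
  -- functions, and decreasing in `n`.
  refine ⟨fun n e => ⨆ e', (f e' - n * dist e e'), fun n => ?_, fun n e => ?_, ?_, fun e => ?_⟩
  · refine LipschitzWith.of_le_add_mul _ fun x y => ?_
    have : Nonempty E := ⟨x⟩
    refine ciSup_le fun e' => ?_
    have h1 := le_ciSup (hbdd n y) e'
    have h2 : (n : ℝ) * dist y e' ≤ n * (dist x y + dist x e') := by
      gcongr
      rw [dist_comm x y]
      exact dist_triangle _ _ _
    simp only [NNReal.coe_natCast]
    linarith
  · have : Nonempty E := ⟨e⟩
    exact abs_le.2 ⟨(abs_le.1 (hB e)).1.trans (hge n e), ciSup_le (hle n e)⟩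
  · intro m n hmn e
    have : Nonempty E := ⟨e⟩
    refine ciSup_mono (hbdd m e) fun e' => ?_
    gcongr
  · rw [Metric.tendsto_atTop]
    intro ε hε
    obtain ⟨δ, hδ, hball⟩ := Metric.eventually_nhds_iff.1 (hf e (f e + ε / 2) (by linarith))
    -- For `n ≥ 2B/δ`, a point at distance at least `δ` contributes at most `B - 2B = -B ≤ f e`, so
    -- only the ball where `f < f e + ε / 2` matters.
    obtain ⟨N, hN⟩ := exists_nat_ge (2 * B / δ)
    refine ⟨N, fun n hn => ?_⟩
    have : Nonempty E := ⟨e⟩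
    have hup : ⨆ e', (f e' - n * dist e e') ≤ f e + ε / 2 := by
      refine ciSup_le fun e' => ?_
      rcases lt_or_ge (dist e' e) δ with h | h
      · have h1 := hball h
        have h2 : 0 ≤ (n : ℝ) * dist e e' := by positivity
        linarith
      · have h1 : 2 * B ≤ n * dist e e' := by
          rw [div_le_iff₀ hδ] at hN
          refine hN.trans ?_
          rw [dist_comm e e']
          gcongr
        linarith [(abs_le.1 (hB e')).2, (abs_le.1 (hB e)).1]
    rw [Real.dist_eq, abs_of_nonneg (by linarith [hge n e])]
    linarith

/-- If every function of a decreasing sequence of continuous functions reaches the level `c` on a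
compact space, then some point is at level at least `c` for all of them. -/
theorem exists_forall_le_of_antitone {A : Type*} [TopologicalSpace A] [CompactSpace A]
    {f : ℕ → A → ℝ} (hf : ∀ n, Continuous (f n)) (hanti : Antitone f) {C : Set A}
    (hC : IsClosed C) {c : ℝ} (h : ∀ n, ∃ a ∈ C, c ≤ f n a) :
    ∃ a ∈ C, ∀ n, c ≤ f n a := by
  have hcl : ∀ n, IsClosed (C ∩ {a | c ≤ f n a}) := fun n =>
    hC.inter (isClosed_le continuous_const (hf n))
  obtain ⟨a, ha⟩ := IsCompact.nonempty_iInter_of_sequence_nonempty_isCompact_isClosed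
    (fun n => C ∩ {a | c ≤ f n a})
    (fun n a ha => ⟨ha.1, le_trans ha.2 (hanti (Nat.le_succ n) a)⟩)
    (fun n => let ⟨a, ha, h'⟩ := h n; ⟨a, ha, h'⟩) (hcl 0).isCompact hcl
  rw [mem_iInter] at ha
  exact ⟨a, (ha 0).1, fun n => (ha n).2⟩

/-- The supremum over a compact space of a function that is continuous in the parameter and
measurable in the other variable is measurable. -/
theorem measurable_iSup_of_continuous {S A : Type*} [MeasurableSpace S] [TopologicalSpace A]
    [CompactSpace A] [TopologicalSpace.SeparableSpace A] {f : S → A → ℝ}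
    (hm : ∀ a, Measurable fun s => f s a) (hc : ∀ s, Continuous (f s)) :
    Measurable fun s => ⨆ a, f s a := by
  have hbdd : ∀ s, BddAbove (range (f s)) := fun s => (isCompact_range (hc s)).bddAbove
  obtain ⟨D, hD, hdense⟩ := TopologicalSpace.exists_countable_dense A
  have : Countable D := hD.to_subtype
  have heq : (fun s => ⨆ a, f s a) = fun s => ⨆ a : D, f s a := by
    funext s
    exact (hdense.ciSup (hc s) (hbdd s)).symm
  rw [heq]
  exact Measurable.iSup fun a => hm a

/-- The set of parameters for which a function, continuous on a compact space, reaches a given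
measurable level on a closed set. -/
theorem measurableSet_exists_mem_le {S A : Type*} [MeasurableSpace S] [TopologicalSpace A]
    [CompactSpace A] [TopologicalSpace.PseudoMetrizableSpace A] {f : S → A → ℝ}
    (hm : ∀ a, Measurable fun s => f s a) (hc : ∀ s, Continuous (f s)) {v : S → ℝ}
    (hv : Measurable v) {C : Set A} (hC : IsClosed C) :
    MeasurableSet {s | ∃ a ∈ C, v s ≤ f s a} := by
  rcases C.eq_empty_or_nonempty with rfl | hne
  · simp
  let := TopologicalSpace.pseudoMetrizableSpacePseudoMetric A
  have : CompactSpace C := isCompact_iff_compactSpace.1 hC.isCompact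
  have : Nonempty C := hne.to_subtype
  have hcont : ∀ s, Continuous fun a : C => f s a := fun s => (hc s).comp continuous_subtype_val
  have heq : {s | ∃ a ∈ C, v s ≤ f s a} = {s | v s ≤ ⨆ a : C, f s a} := by
    ext s
    constructor
    · rintro ⟨a, ha, h⟩
      exact h.trans (le_ciSup (isCompact_range (hcont s)).bddAbove (⟨a, ha⟩ : C))
    · intro h
      obtain ⟨a, -, ha⟩ := isCompact_univ.exists_sSup_image_eq univ_nonempty (hcont s).continuousOn
      rw [image_univ] at ha
      exact ⟨a, a.2, h.trans_eq ha⟩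
  rw [heq]
  exact measurableSet_le hv (measurable_iSup_of_continuous (fun a : C => hm a) hcont)

/-- Measurable selection from the superlevel sets of a decreasing limit of functions that are
measurable in one variable and continuous in the other, which ranges over a compact space. -/
theorem exists_measurable_forall_le {S A : Type*} [MeasurableSpace S] [TopologicalSpace A]
    [CompactSpace A] [TopologicalSpace.MetrizableSpace A] [MeasurableSpace A] [BorelSpace A]
    [Nonempty A] {f : ℕ → S → A → ℝ} (hm : ∀ n a, Measurable fun s => f n s a)
    (hc : ∀ n s, Continuous (f n s)) (hanti : Antitone f) {v : S → ℝ} (hv : Measurable v)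
    (h : ∀ s, ∃ a, ∀ n, v s ≤ f n s a) :
    ∃ φ : S → A, Measurable φ ∧ ∀ s n, v s ≤ f n s (φ s) := by
  let := TopologicalSpace.metrizableSpaceMetric A
  -- The Cantor set maps continuously onto `A` and is ordered as a subset of `ℝ`, so a compact set
  -- of parameters has a canonical point, its least element.
  obtain ⟨ψ₀, hψ₀, hsurj₀⟩ := exists_nat_bool_continuous_surjective_of_compact A
  have : CompactSpace cantorSet := isCompact_iff_compactSpace.1 isCompact_cantorSet
  obtain ⟨ψ, hψ, hsurj⟩ : ∃ ψ : cantorSet → A, Continuous ψ ∧ Function.Surjective ψ :=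
    ⟨ψ₀ ∘ cantorSetHomeomorphNatToBool, hψ₀.comp cantorSetHomeomorphNatToBool.continuous,
      hsurj₀.comp cantorSetHomeomorphNatToBool.surjective⟩
  let K : S → Set cantorSet := fun s => {c | ∀ n, v s ≤ f n s (ψ c)}
  have hKcomp : ∀ s, IsCompact (Subtype.val '' K s : Set ℝ) := fun s => by
    have : IsClosed (K s) := by
      simp only [K, ofPred_forall]
      exact isClosed_iInter fun n => isClosed_le continuous_const ((hc n s).comp hψ)
    exact this.isCompact.image continuous_subtype_val
  have hKne : ∀ s, (Subtype.val '' K s : Set ℝ).Nonempty := fun s => by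
    obtain ⟨a, ha⟩ := h s
    obtain ⟨c, rfl⟩ := hsurj a
    exact ⟨c, c, ha, rfl⟩
  have hmem : ∀ s, sInf (Subtype.val '' K s : Set ℝ) ∈ (Subtype.val '' K s : Set ℝ) := fun s =>
    (hKcomp s).sInf_mem (hKne s)
  choose m hmK hm_eq using hmem
  have hmeas : Measurable fun s => (m s : ℝ) := by
    refine measurable_of_Iic fun t => ?_
    -- The least parameter is at most `t` iff some parameter at most `t` reaches the level for all
    -- `n`. By compactness it suffices that each `n` separately has one.
    have heq : (fun s => (m s : ℝ)) ⁻¹' Iic t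
        = ⋂ n, {s | ∃ a ∈ ψ '' {c | (c : ℝ) ≤ t}, v s ≤ f n s a} := by
      ext s
      simp only [mem_preimage, mem_Iic, mem_iInter, mem_ofPred_eq]
      constructor
      · intro hs n
        exact ⟨ψ (m s), ⟨m s, hs, rfl⟩, hmK s n⟩
      · intro hs
        obtain ⟨c, hct, hcK⟩ := exists_forall_le_of_antitone
          (f := fun n c => f n s (ψ c)) (fun n => (hc n s).comp hψ)
          (fun _ _ hij c => hanti hij s (ψ c))
          (isClosed_le continuous_subtype_val continuous_const :
            IsClosed {c : cantorSet | (c : ℝ) ≤ t})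
          (fun n => by
            obtain ⟨_, ⟨c, hct, rfl⟩, hle⟩ := hs n
            exact ⟨c, hct, hle⟩)
        rw [hm_eq]
        exact (csInf_le (hKcomp s).bddBelow ⟨c, hcK, rfl⟩).trans hct
    rw [heq]
    refine MeasurableSet.iInter fun n => measurableSet_exists_mem_le (hm n) (hc n) hv ?_
    exact ((isClosed_le continuous_subtype_val continuous_const).isCompact.image hψ).isClosed
  exact ⟨fun s => ψ (m s), hψ.measurable.comp hmeas.subtype_mk, fun s n => hmK s n⟩

/-! ### The one-period Bellman operator -/

instance : Countable Regime :=
  Function.Injective.countable (f := fun z : Regime => (z.ctorIdx : ℕ)) (by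
    intro z z' h
    cases z <;> cases z' <;> first | rfl | cases h)

instance : DiscreteMeasurableSpace Regime := ⟨fun _ => trivial⟩

namespace PortfolioMDP

variable {X Y : Type*} [MeasurableSpace X] [MeasurableSpace Y] {d : ℕ} {M : PortfolioMDP X Y d}

theorem continuous_grossReturn :
    Continuous fun p : Weights d × Weights d => grossReturn p.1 p.2 := by
  unfold grossReturn
  fun_prop

theorem measurable_prod_regime {E : Type*} [MeasurableSpace E] {r : Regime → E → ℝ}
    (hr : ∀ z, Measurable (r z)) : Measurable fun p : Regime × E => r p.1 p.2 :=
  measurable_from_prod_countable_right hr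

/-- The one-period return of action `a` in state `s` with continuation value `V`. -/
def bellman (M : PortfolioMDP X Y d) (V : M.State → ℝ) (s : M.State) (a : M.Action) : ℝ :=
  ∫ o, (M.netReward s a o.2 + M.discount * V o.1) ∂(M.kernel (s, a))

/-- The net reward in a given regime, as a function of holdings, action and asset returns. -/
def regimeReward (M : PortfolioMDP X Y d) (z : Regime)
    (p : M.holdings × M.Action × Weights d) : ℝ :=
  grossReturn (p.2.1 : Weights d) p.2.2 - M.cost z ((p.2.1 : Weights d) - (p.1 : Weights d))
    - M.riskWeight * M.riskProxy (-grossReturn (p.2.1 : Weights d) p.2.2)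

/-- The one-period return of action `a` in state `s` when the rewards are `r` and the continuation
value is `V`. -/
def rewardBellman (M : PortfolioMDP X Y d) (r : Regime → M.holdings × M.Action × Weights d → ℝ)
    (V : M.State → ℝ) (s : M.State) (a : M.Action) : ℝ :=
  ∫ o, (r s.2.2.2 (s.2.2.1, a, o.2) + M.discount * V o.1) ∂(M.kernel (s, a))

section rewardBellman

variable {r r' : Regime → M.holdings × M.Action × Weights d → ℝ} {V V' : M.State → ℝ} {R B : ℝ}

theorem measurable_reward_comp (hr : ∀ z, Measurable (r z)) :
    Measurable fun p : (M.State × M.Action) × M.Obs =>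
      r p.1.1.2.2.2 (p.1.1.2.2.1, p.1.2, p.2.2) :=
  (measurable_prod_regime hr).comp
    (g := fun p : Regime × (M.holdings × M.Action × Weights d) => r p.1 p.2)
    (f := fun p : (M.State × M.Action) × M.Obs =>
      (p.1.1.2.2.2, (p.1.1.2.2.1, p.1.2, p.2.2))) (by fun_prop)

theorem measurable_reward_obs (hr : ∀ z, Measurable (r z)) (s : M.State) (a : M.Action) :
    Measurable fun o : M.Obs => r s.2.2.2 (s.2.2.1, a, o.2) :=
  (hr _).comp (by fun_prop)

theorem abs_reward_add_le (hγ : 0 ≤ M.discount) (hrR : ∀ z p, |r z p| ≤ R) (hVB : ∀ s, |V s| ≤ B)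
    (s : M.State) (a : M.Action) (o : M.Obs) :
    |r s.2.2.2 (s.2.2.1, a, o.2) + M.discount * V o.1| ≤ R + M.discount * B := by
  refine (abs_add_le _ _).trans (add_le_add (hrR _ _) ?_)
  rw [abs_mul, abs_of_nonneg hγ]
  exact mul_le_mul_of_nonneg_left (hVB _) hγ

theorem integrable_reward_add (hγ : 0 ≤ M.discount) (hr : ∀ z, Measurable (r z))
    (hrR : ∀ z p, |r z p| ≤ R) (hV : Measurable V) (hVB : ∀ s, |V s| ≤ B) (s : M.State)
    (a : M.Action) :
    Integrable (fun o : M.Obs => r s.2.2.2 (s.2.2.1, a, o.2) + M.discount * V o.1)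
      (M.kernel (s, a)) := by
  refine Integrable.of_bound (C := R + M.discount * B) ?_ (.of_forall fun o => ?_)
  · exact ((measurable_reward_obs hr s a).add
      ((hV.comp measurable_fst).const_mul _)).aestronglyMeasurable
  · exact abs_reward_add_le hγ hrR hVB s a o

theorem abs_rewardBellman_le (hγ : 0 ≤ M.discount) (hrR : ∀ z p, |r z p| ≤ R)
    (hVB : ∀ s, |V s| ≤ B) (s : M.State) (a : M.Action) :
    |M.rewardBellman r V s a| ≤ R + M.discount * B := by
  have := norm_integral_le_of_norm_le_const (μ := M.kernel (s, a))
    (f := fun o => r s.2.2.2 (s.2.2.1, a, o.2) + M.discount * V o.1)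
    (.of_forall fun o => abs_reward_add_le hγ hrR hVB s a o)
  simpa [rewardBellman] using this

theorem rewardBellman_mono (hγ : 0 ≤ M.discount) (hr : ∀ z, Measurable (r z))
    (hrR : ∀ z p, |r z p| ≤ R) (hV : Measurable V) (hVB : ∀ s, |V s| ≤ B)
    (hr' : ∀ z, Measurable (r' z)) (hrR' : ∀ z p, |r' z p| ≤ R) (hV' : Measurable V')
    (hVB' : ∀ s, |V' s| ≤ B) (hrr : r ≤ r') (hVV : V ≤ V') :
    M.rewardBellman r V ≤ M.rewardBellman r' V' := fun s a =>
  integral_mono (integrable_reward_add hγ hr hrR hV hVB s a)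
    (integrable_reward_add hγ hr' hrR' hV' hVB' s a)
    fun _ => add_le_add (hrr _ _) (mul_le_mul_of_nonneg_left (hVV _) hγ)

theorem measurable_rewardBellman (hr : ∀ z, Measurable (r z)) (hV : Measurable V) :
    Measurable fun p : M.State × M.Action => M.rewardBellman r V p.1 p.2 := by
  have h : Measurable fun p : (M.State × M.Action) × M.Obs =>
      r p.1.1.2.2.2 (p.1.1.2.2.1, p.1.2, p.2.2) + M.discount * V p.2.1 :=
    (measurable_reward_comp hr).add
      ((hV.comp (measurable_fst.comp measurable_snd)).const_mul _)
  exact (h.stronglyMeasurable.integral_kernel_prod_right' (κ := M.kernel)).measurable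

/-- The parameters `(w, a)` enter both the integrand and the kernel, whereas the continuity of the
environment concerns a fixed integrand. Freezing them in the reward at `p₀` costs at most `k * dist
p.2 p₀.2`, uniformly in the returns; this is why the rewards are taken Lipschitz and not merely
continuous. -/
theorem continuous_rewardBellman [TopologicalSpace Y] (hM : M.ContinuousEnvironment)
    (hγ : 0 ≤ M.discount) {k : NNReal} (hr : ∀ z, LipschitzWith k (r z))
    (hrR : ∀ z p, |r z p| ≤ R) (hV : Measurable V) (hVB : ∀ s, |V s| ≤ B)
    (hVc : ∀ x z, Continuous fun p : Y × M.holdings => V (x, p.1, p.2, z)) (x : X) (z : Regime) :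
    Continuous fun p : Y × M.holdings × M.Action =>
      M.rewardBellman r V (x, p.1, p.2.1, z) p.2.2 := by
  have hrm : ∀ z, Measurable (r z) := fun z => (hr z).continuous.measurable
  rw [continuous_iff_continuousAt]
  intro p₀
  let f : M.Obs → ℝ := fun o => r z (p₀.2.1, p₀.2.2, o.2) + M.discount * V o.1
  have hf : Measurable f := ((hrm z).comp (by fun_prop)).add ((hV.comp measurable_fst).const_mul _)
  have hfB : ∀ o, |f o| ≤ R + M.discount * B := fun o =>
    abs_reward_add_le hγ hrR hVB (x, p₀.1, p₀.2.1, z) p₀.2.2 o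
  have hcont := hM f hf ⟨_, hfB⟩ (fun x' z' => by
    refine ((hr z).continuous.comp (by fun_prop)).add (continuous_const.mul ?_)
    exact (hVc x' z').comp (f := fun p : Y × M.holdings × Weights d => (p.1, p.2.1))
      (by fun_prop)) x z
  have hdist : ∀ p : Y × M.holdings × M.Action,
      |M.rewardBellman r V (x, p.1, p.2.1, z) p.2.2
        - ∫ o, f o ∂(M.kernel ((x, p.1, p.2.1, z), p.2.2))| ≤ k * dist p.2 p₀.2 := by
    intro p
    have hfi : Integrable f (M.kernel ((x, p.1, p.2.1, z), p.2.2)) :=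
      Integrable.of_bound hf.aestronglyMeasurable (R + M.discount * B) (.of_forall hfB)
    rw [rewardBellman, ← integral_sub
      (integrable_reward_add hγ hrm hrR hV hVB (x, p.1, p.2.1, z) p.2.2) hfi]
    have hb : ∀ o : M.Obs, ‖(r z (p.2.1, p.2.2, o.2) + M.discount * V o.1) - f o‖
        ≤ k * dist p.2 p₀.2 := fun o => by
      have h1 := (hr z).dist_le_mul (p.2.1, p.2.2, o.2) (p₀.2.1, p₀.2.2, o.2)
      have h2 : dist ((p.2.1, p.2.2, o.2) : M.holdings × M.Action × Weights d)
          (p₀.2.1, p₀.2.2, o.2) = dist p.2 p₀.2 := by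
        simp [Prod.dist_eq]
      rw [h2, Real.dist_eq] at h1
      simp only [f, Real.norm_eq_abs, add_sub_add_right_eq_sub]
      exact h1
    have := norm_integral_le_of_norm_le_const
      (μ := M.kernel ((x, p.1, p.2.1, z), p.2.2)) (.of_forall hb)
    simpa using this
  have hzero : Tendsto (fun p : Y × M.holdings × M.Action =>
      M.rewardBellman r V (x, p.1, p.2.1, z) p.2.2
        - ∫ o, f o ∂(M.kernel ((x, p.1, p.2.1, z), p.2.2))) (𝓝 p₀) (𝓝 0) := by
    refine squeeze_zero_norm hdist ?_
    have : Continuous fun p : Y × M.holdings × M.Action => (k : ℝ) * dist p.2 p₀.2 := by fun_prop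
    simpa using this.tendsto p₀
  have := hzero.add (hcont.tendsto p₀)
  simp only [sub_add_cancel, zero_add] at this
  exact this

end rewardBellman

/-! ### Semicontinuity and approximation of the reward -/

theorem Regular.continuous_riskProxy [TopologicalSpace Y] (hM : M.Regular) :
    Continuous M.riskProxy := by
  rw [continuous_iff_continuousAt]
  intro t
  obtain ⟨L, hL⟩ := hM.riskProxy_lipschitz _ (isCompact_closedBall t 1)
  exact hL.continuousOn.continuousAt (Metric.closedBall_mem_nhds t one_pos)

/-- Every trade `a - w` lies in the set on which the cost is lower semicontinuous, and the remaining
terms are continuous. -/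
theorem Regular.upperSemicontinuous_regimeReward [TopologicalSpace Y] (hM : M.Regular)
    (z : Regime) : UpperSemicontinuous (M.regimeReward z) := by
  have hcost : LowerSemicontinuous fun p : M.holdings × M.Action × Weights d =>
      M.cost z ((p.2.1 : Weights d) - (p.1 : Weights d)) := by
    rw [← lowerSemicontinuousOn_univ_iff]
    exact (hM.cost_lsc z).comp
      (g := fun p : M.holdings × M.Action × Weights d => (p.2.1 : Weights d) - (p.1 : Weights d))
      (by fun_prop) fun p _ => sub_mem_sub p.2.1.2 p.1.2
  have hg : Continuous fun p : M.holdings × M.Action × Weights d =>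
      grossReturn (p.2.1 : Weights d) p.2.2 := continuous_grossReturn.comp
    (f := fun p : M.holdings × M.Action × Weights d => ((p.2.1 : Weights d), p.2.2)) (by fun_prop)
  have hcont : Continuous fun p : M.holdings × M.Action × Weights d =>
      grossReturn (p.2.1 : Weights d) p.2.2
        - M.riskWeight * M.riskProxy (-grossReturn (p.2.1 : Weights d) p.2.2) :=
    hg.sub (continuous_const.mul (hM.continuous_riskProxy.comp hg.neg))
  intro p y hy
  simp only [regimeReward] at hy ⊢
  set ε := y - (grossReturn (p.2.1 : Weights d) p.2.2
    - M.cost z ((p.2.1 : Weights d) - (p.1 : Weights d))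
    - M.riskWeight * M.riskProxy (-grossReturn (p.2.1 : Weights d) p.2.2)) with hε
  have hε0 : 0 < ε := sub_pos.2 hy
  filter_upwards [hcost p _ (sub_lt_self _ (half_pos hε0)),
    hcont.upperSemicontinuous p _ (lt_add_of_pos_right _ (half_pos hε0))] with q h1 h2
  linarith

/-- The reward is bounded only almost surely, so it is truncated first. Truncation by constants
preserves upper semicontinuity. -/
theorem Regular.exists_reward_approx [TopologicalSpace Y] (hM : M.Regular) {R : ℝ} (hR : 0 ≤ R) :
    ∃ r : ℕ → Regime → M.holdings × M.Action × Weights d → ℝ,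
      (∀ (n : ℕ) z, LipschitzWith n (r n z)) ∧ (∀ n z p, |r n z p| ≤ R) ∧ Antitone r ∧
      ∀ z p, Tendsto (fun n => r n z p) atTop (𝓝 (max (-R) (min R (M.regimeReward z p)))) := by
  have h : ∀ z, ∃ g : ℕ → M.holdings × M.Action × Weights d → ℝ,
      (∀ n : ℕ, LipschitzWith n (g n)) ∧ (∀ n e, |g n e| ≤ R) ∧ Antitone g ∧
      ∀ e, Tendsto (fun n => g n e) atTop (𝓝 (max (-R) (min R (M.regimeReward z e)))) := fun z => by
    refine UpperSemicontinuous.exists_antitone_lipschitz_tendsto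
      (upperSemicontinuous_const.sup
        (upperSemicontinuous_const.inf (hM.upperSemicontinuous_regimeReward z))) fun e => ?_
    exact abs_le.2 ⟨le_max_left _ _, max_le (by linarith) (min_le_left _ _)⟩
  choose g h1 h2 h3 h4 using h
  exact ⟨fun n z => g z n, fun n z => h1 z n, fun n z => h2 z n, fun m n hmn z => h3 z hmn, h4⟩

theorem Regular.measurable_netReward [TopologicalSpace Y] (hM : M.Regular) :
    Measurable fun p : (M.State × M.Action) × M.Obs => M.netReward p.1.1 p.1.2 p.2.2 :=
  measurable_reward_comp (r := M.regimeReward)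
    fun z => (hM.upperSemicontinuous_regimeReward z).measurable

/-! ### Value iteration and the optimality equation -/

/-- Value iteration started at the constant `B`, with the reward `r n` in step `n`. -/
def valueIteration (M : PortfolioMDP X Y d)
    (r : ℕ → Regime → M.holdings × M.Action × Weights d → ℝ) (B : ℝ) : ℕ → M.State → ℝ
  | 0 => fun _ => B
  | n + 1 => fun s => ⨆ a, M.rewardBellman (r n) (valueIteration M r B n) s a

section valueIteration

variable [TopologicalSpace Y] {r : ℕ → Regime → M.holdings × M.Action × Weights d → ℝ} {R B : ℝ}

theorem continuous_action_of_continuous {f : M.State → M.Action → ℝ}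
    (hf : ∀ x z, Continuous fun p : Y × M.holdings × M.Action => f (x, p.1, p.2.1, z) p.2.2)
    (s : M.State) : Continuous (f s) :=
  (hf s.1 s.2.2.2).comp (f := fun a : M.Action => (s.2.1, s.2.2.1, a)) (by fun_prop)

/-- The three properties must be carried together: they are what `continuous_rewardBellman` needs of
the continuation value, and a supremum over the compact action set preserves them. -/
theorem Regular.valueIteration_regular (hM : M.Regular) (hr : ∀ (n : ℕ) z, LipschitzWith n (r n z))
    (hrR : ∀ n z p, |r n z p| ≤ R) (hRB : R + M.discount * B ≤ B) (hB : 0 ≤ B) (n : ℕ) :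
    Measurable (M.valueIteration r B n) ∧ (∀ s, |M.valueIteration r B n s| ≤ B) ∧
      ∀ x z, Continuous fun p : Y × M.holdings => M.valueIteration r B n (x, p.1, p.2, z) := by
  have : CompactSpace M.Action := isCompact_iff_compactSpace.1 hM.actions_compact
  have : Nonempty M.Action := hM.actions_nonempty.to_subtype
  induction n with
  | zero =>
    exact ⟨measurable_const, fun _ => (abs_of_nonneg hB).le, fun _ _ => continuous_const⟩
  | succ n ih =>
    obtain ⟨hm, hb, hc⟩ := ih
    have hQc := continuous_rewardBellman hM.continuousEnvironment hM.discount_nonneg (hr n)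
      (hrR n) hm hb hc
    have hQa := continuous_action_of_continuous hQc
    have hQb := fun s a => (abs_rewardBellman_le hM.discount_nonneg (hrR n) hb s a).trans hRB
    refine ⟨?_, fun s => abs_le.2 ⟨?_, ciSup_le fun a => (abs_le.1 (hQb s a)).2⟩, fun x z => ?_⟩
    · refine measurable_iSup_of_continuous (fun a => ?_) hQa
      exact (measurable_rewardBellman (fun z => (hr n z).continuous.measurable) hm).comp
        (measurable_id.prodMk measurable_const)
    · have a : M.Action := Classical.arbitrary _
      exact (abs_le.1 (hQb s a)).1.trans (le_ciSup (isCompact_range (hQa s)).bddAbove a)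
    · have := isCompact_univ.continuous_sSup
        (f := fun (p : Y × M.holdings) (a : M.Action) =>
          M.rewardBellman (r n) (M.valueIteration r B n) (x, p.1, p.2, z) a)
        ((hQc x z).comp (f := fun p : (Y × M.holdings) × M.Action => (p.1.1, p.1.2, p.2))
          (by fun_prop))
      simp only [image_univ] at this
      exact this

/-- The start `B` dominates the first iterate. Afterwards both the reward and the continuation value
decrease from one step to the next, and the operator is monotone in both. -/
theorem Regular.antitone_valueIteration (hM : M.Regular)
    (hr : ∀ (n : ℕ) z, LipschitzWith n (r n z)) (hrR : ∀ n z p, |r n z p| ≤ R)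
    (hanti : Antitone r) (hRB : R + M.discount * B ≤ B) (hB : 0 ≤ B) :
    Antitone (M.valueIteration r B) := by
  have : CompactSpace M.Action := isCompact_iff_compactSpace.1 hM.actions_compact
  have : Nonempty M.Action := hM.actions_nonempty.to_subtype
  have hreg := hM.valueIteration_regular hr hrR hRB hB
  have hrm : ∀ n z, Measurable (r n z) := fun n z => (hr n z).continuous.measurable
  refine antitone_nat_of_succ_le fun n => ?_
  induction n with
  | zero => exact fun s => (abs_le.1 ((hreg 1).2.1 s)).2
  | succ n ih =>
    intro s
    have hQa := continuous_action_of_continuous (continuous_rewardBellman hM.continuousEnvironment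
      hM.discount_nonneg (hr n) (hrR n) (hreg n).1 (hreg n).2.1 (hreg n).2.2)
    exact ciSup_mono (isCompact_range (hQa s)).bddAbove fun a =>
      rewardBellman_mono hM.discount_nonneg (hrm _) (hrR _) (hreg _).1 (hreg _).2.1 (hrm _)
        (hrR _) (hreg _).1 (hreg _).2.1 (hanti (Nat.le_succ n)) ih s a

end valueIteration

theorem Regular.exists_reward_bound [TopologicalSpace Y] (hM : M.Regular) :
    ∃ R : ℝ, 0 ≤ R ∧ ∀ s a, ∀ᵐ o ∂(M.kernel (s, a)), |M.netReward s a o.2| ≤ R := by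
  obtain ⟨R, hR⟩ := hM.reward_bounded
  exact ⟨|R|, abs_nonneg R, fun s a => (hR s a).mono fun o ho => ho.trans (le_abs_self R)⟩

/-- The optimality equation has a bounded measurable solution, whose right-hand side is maximized
by a measurable function of the state. -/
theorem Regular.exists_optimality_equation [TopologicalSpace Y] (hM : M.Regular) :
    ∃ (V : M.State → ℝ) (φ : M.State → M.Action) (B : ℝ), Measurable V ∧ Measurable φ ∧
      (∀ s, |V s| ≤ B) ∧ (∀ s a, M.bellman V s a ≤ V s) ∧ ∀ s, M.bellman V s (φ s) = V s := by
  have : CompactSpace M.Action := isCompact_iff_compactSpace.1 hM.actions_compact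
  have : Nonempty M.Action := hM.actions_nonempty.to_subtype
  obtain ⟨R, hR0, hR⟩ := hM.exists_reward_bound
  obtain ⟨r, hr, hrR, hanti, hlim⟩ := hM.exists_reward_approx hR0
  have hγ := hM.discount_nonneg
  have hγ' : 0 < 1 - M.discount := sub_pos.2 hM.discount_lt_one
  -- The fixed point of `B ↦ R + γ B`, hence a bound that value iteration preserves.
  set B : ℝ := R / (1 - M.discount) with hBdef
  have hB : 0 ≤ B := div_nonneg hR0 hγ'.le
  have hRB : R + M.discount * B ≤ B := by
    have : B * (1 - M.discount) = R := div_mul_cancel₀ _ hγ'.ne'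
    linarith
  have hrm : ∀ n z, Measurable (r n z) := fun n z => (hr n z).continuous.measurable
  have hreg := hM.valueIteration_regular hr hrR hRB hB
  have hVanti := hM.antitone_valueIteration hr hrR hanti hRB hB
  set W := M.valueIteration r B with hW
  let V : M.State → ℝ := fun s => ⨅ n, W n s
  have hbdd : ∀ s, BddBelow (range fun n => W n s) := fun s =>
    ⟨-B, by rintro _ ⟨n, rfl⟩; exact (abs_le.1 ((hreg n).2.1 s)).1⟩
  have hVlim : ∀ s, Tendsto (fun n => W n s) atTop (𝓝 (V s)) := fun s =>
    tendsto_atTop_ciInf (fun _ _ hmn => hVanti hmn s) (hbdd s)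
  have hVm : Measurable V := Measurable.iInf fun n => (hreg n).1
  have hVB : ∀ s, |V s| ≤ B := fun s => le_of_tendsto' (hVlim s).abs fun n => (hreg n).2.1 s
  let q : ℕ → M.State → M.Action → ℝ := fun n => M.rewardBellman (r n) (W n)
  have hqc : ∀ n s, Continuous (q n s) := fun n =>
    continuous_action_of_continuous (continuous_rewardBellman hM.continuousEnvironment
      hγ (hr n) (hrR n) (hreg n).1 (hreg n).2.1 (hreg n).2.2)
  have hqm : ∀ n a, Measurable fun s => q n s a := fun n a =>
    (measurable_rewardBellman (hrm n) (hreg n).1).comp (measurable_id.prodMk measurable_const)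
  have hqanti : Antitone q := fun m n hmn =>
    rewardBellman_mono hγ (hrm _) (hrR _) (hreg _).1 (hreg _).2.1 (hrm _)
        (hrR _) (hreg _).1 (hreg _).2.1 (hanti hmn) (hVanti hmn)
  have hqlim : ∀ s a, Tendsto (fun n => q n s a) atTop (𝓝 (M.bellman V s a)) := fun s a => by
    refine tendsto_integral_of_dominated_convergence (fun _ => R + M.discount * B)
      (fun n => (integrable_reward_add hγ (hrm n) (hrR n) (hreg n).1 (hreg n).2.1 s a).1)
      (integrable_const _)
      (fun n => .of_forall fun o => abs_reward_add_le hγ (hrR n) (hreg n).2.1 s a o) ?_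
    -- Almost surely the reward lies in `[-R, R]`, where truncation is the identity.
    filter_upwards [hR s a] with o ho
    have h := hlim s.2.2.2 (s.2.2.1, a, o.2)
    have heq : max (-R) (min R (M.regimeReward s.2.2.2 (s.2.2.1, a, o.2)))
        = M.netReward s a o.2 := by
      have h2 := abs_le.1 ho
      change max (-R) (min R (M.netReward s a o.2)) = _
      rw [min_eq_right h2.2, max_eq_right h2.1]
    rw [heq] at h
    exact h.add ((hVlim o.1).const_mul _)
  have hqV : ∀ n s, W (n + 1) s = ⨆ a, q n s a := fun n s => rfl
  have hqle : ∀ n s a, q n s a ≤ W (n + 1) s := fun n s a =>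
    (le_ciSup (isCompact_range (hqc n s)).bddAbove a).trans_eq (hqV n s).symm
  have hle : ∀ s a, M.bellman V s a ≤ V s := fun s a =>
    le_of_tendsto_of_tendsto' (hqlim s a) ((tendsto_add_atTop_iff_nat 1).2 (hVlim s))
      fun n => hqle n s a
  -- Each `q n s` attains its maximum `W (n + 1) s ≥ V s`, so compactness gives one action at level
  -- `V s` for all `n`. Passing to the limit along the selector yields `V s ≤ bellman V s (φ s)`.
  obtain ⟨φ, hφ, hsel⟩ := exists_measurable_forall_le hqm hqc hqanti hVm fun s => by
    obtain ⟨a, -, ha⟩ := exists_forall_le_of_antitone (fun n => hqc n s)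
      (fun _ _ hmn => hqanti hmn s) isClosed_univ (c := V s) fun n => by
        obtain ⟨a, -, ha⟩ :=
          isCompact_univ.exists_sSup_image_eq univ_nonempty (hqc n s).continuousOn
        rw [image_univ] at ha
        exact ⟨a, mem_univ a, ((ciInf_le (hbdd s) (n + 1)).trans_eq (hqV n s)).trans_eq ha⟩
    exact ⟨a, ha⟩
  exact ⟨V, φ, B, hVm, hφ, hVB, hle, fun s =>
    (hle s _).antisymm (ge_of_tendsto' (hqlim s (φ s)) (hsel s))⟩

end PortfolioMDP

/-! ### The law of the controlled process -/

theorem ae_dirac_eq_self {A : Type*} [MeasurableSpace A] [MeasurableSingletonClass A] (a : A) :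
    ∀ᵐ b ∂(Measure.dirac a), b = a :=
  (ae_dirac_iff (measurableSet_singleton a)).2 rfl

namespace PortfolioMDP

variable {X Y : Type*} [MeasurableSpace X] [MeasurableSpace Y] {d : ℕ} {M : PortfolioMDP X Y d}

instance (μ₀ : Measure M.State) [IsProbabilityMeasure μ₀] (π : M.Policy) :
    IsProbabilityMeasure (M.initialLaw μ₀ π) :=
  Measure.isProbabilityMeasure_map (by fun_prop)

instance (μ₀ : Measure M.State) [IsProbabilityMeasure μ₀] (π : M.Policy) :
    IsProbabilityMeasure (M.pathLaw μ₀ π) := by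
  unfold pathLaw; infer_instance

section pathLaw

theorem map_zero_pathLaw (μ₀ : Measure M.State) (π : M.Policy) :
    (M.pathLaw μ₀ π).map (fun ω => ω 0) = M.initialLaw μ₀ π := by
  have h1 : (fun ω : ℕ → M.Epoch => ω 0)
      = (fun h : Finset.Iic 0 → M.Epoch => h ⟨0, Finset.mem_Iic.2 le_rfl⟩) ∘
        Preorder.frestrictLe (π := fun _ => M.Epoch) 0 := rfl
  rw [h1, ← Measure.map_map (by fun_prop) (by fun_prop), pathLaw, Kernel.trajMeasure,
    Measure.map_comp _ _ (by fun_prop), Kernel.traj_map_frestrictLe, Kernel.partialTraj_self,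
    Measure.id_comp, Measure.map_map (by fun_prop) (by fun_prop)]
  exact Measure.map_id

variable (μ₀ : Measure M.State) [IsProbabilityMeasure μ₀] (π : M.Policy)

theorem map_state_zero_pathLaw : (M.pathLaw μ₀ π).map (fun ω => (ω 0).1.1) = μ₀ := by
  have h1 : (fun ω : ℕ → M.Epoch => (ω 0).1.1) = (fun e : M.Epoch => e.1.1) ∘ fun ω => ω 0 := rfl
  rw [h1, ← Measure.map_map (by fun_prop) (by fun_prop), map_zero_pathLaw, initialLaw,
    Measure.map_map (by fun_prop) (by fun_prop)]
  exact Measure.fst_compProd μ₀ π.init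

/-- Discarding the new action from `epochKernel` removes the policy: given the whole past, the next
observation depends only on the last state and action. -/
theorem map_frestrictLe_obs_pathLaw (n : ℕ) :
    (M.pathLaw μ₀ π).map
        (fun ω => (Preorder.frestrictLe (π := fun _ => M.Epoch) n ω, (ω (n + 1)).1))
      = ((M.pathLaw μ₀ π).map (Preorder.frestrictLe (π := fun _ => M.Epoch) n)) ⊗ₘ
        (M.kernel.comap
          (fun h : Finset.Iic n → M.Epoch =>
            ((h ⟨n, Finset.mem_Iic.2 le_rfl⟩).1.1, (h ⟨n, Finset.mem_Iic.2 le_rfl⟩).2))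
          (by fun_prop)) := by
  have h1 : (M.epochKernel π n).map Prod.fst = M.kernel.comap
      (fun h : Finset.Iic n → M.Epoch =>
        ((h ⟨n, Finset.mem_Iic.2 le_rfl⟩).1.1, (h ⟨n, Finset.mem_Iic.2 le_rfl⟩).2))
      (by fun_prop) := by
    rw [← Kernel.fst_eq, epochKernel, Kernel.fst_compProd]
  rw [← h1, Measure.compProd_map (by fun_prop), pathLaw,
    Kernel.map_frestrictLe_trajMeasure_compProd_eq_map_trajMeasure
      (X := fun _ => M.Epoch) (κ := M.epochKernel π),
    Measure.map_map (by fun_prop) (by fun_prop)]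
  rfl

variable {μ₀ π} in
theorem integral_pathLaw_obs_succ (n : ℕ) {f : M.Epoch × M.Obs → ℝ} (hf : Measurable f)
    (hi : Integrable (fun ω => f (ω n, (ω (n + 1)).1)) (M.pathLaw μ₀ π)) :
    ∫ ω, f (ω n, (ω (n + 1)).1) ∂(M.pathLaw μ₀ π)
      = ∫ ω, ∫ o, f (ω n, o) ∂(M.kernel ((ω n).1.1, (ω n).2)) ∂(M.pathLaw μ₀ π) := by
  let g : (Finset.Iic n → M.Epoch) × M.Obs → ℝ :=
    fun p => f (p.1 ⟨n, Finset.mem_Iic.2 le_rfl⟩, p.2)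
  have hg : Measurable g := hf.comp (by fun_prop)
  have hT : Measurable fun ω : ℕ → M.Epoch =>
      (Preorder.frestrictLe (π := fun _ => M.Epoch) n ω, (ω (n + 1)).1) := by fun_prop
  have hi' := (integrable_map_measure (μ := M.pathLaw μ₀ π) (g := g)
    hg.aestronglyMeasurable hT.aemeasurable).2 hi
  have h1 := integral_map (μ := M.pathLaw μ₀ π) hT.aemeasurable (f := g) hg.aestronglyMeasurable
  rw [map_frestrictLe_obs_pathLaw] at h1 hi'
  refine h1.symm.trans ?_
  rw [Measure.integral_compProd hi', integral_map (by fun_prop)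
    (hg.stronglyMeasurable.integral_kernel_prod_right').aestronglyMeasurable]
  rfl

theorem ae_pathLaw_obs_succ (n : ℕ) {p : M.Epoch × M.Obs → Prop} (hp : MeasurableSet {x | p x})
    (h : ∀ e : M.Epoch, ∀ᵐ o ∂(M.kernel (e.1.1, e.2)), p (e, o)) :
    ∀ᵐ ω ∂(M.pathLaw μ₀ π), p (ω n, (ω (n + 1)).1) := by
  have hT : Measurable fun ω : ℕ → M.Epoch =>
      (Preorder.frestrictLe (π := fun _ => M.Epoch) n ω, (ω (n + 1)).1) := by fun_prop
  refine ae_of_ae_map (p := fun q : (Finset.Iic n → M.Epoch) × M.Obs =>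
    p (q.1 ⟨n, Finset.mem_Iic.2 le_rfl⟩, q.2)) hT.aemeasurable ?_
  rw [map_frestrictLe_obs_pathLaw]
  refine (Measure.ae_compProd_iff ?_).2 (.of_forall fun q => h _)
  exact hp.preimage (f := fun q : (Finset.Iic n → M.Epoch) × M.Obs =>
    (q.1 ⟨n, Finset.mem_Iic.2 le_rfl⟩, q.2)) (by fun_prop)

/-- Under a deterministic stationary policy, the actions are functions of the states. -/
theorem ae_pathLaw_stationary_deterministic {φ : M.State → M.Action} (hφ : Measurable φ) (n : ℕ) :
    ∀ᵐ ω ∂(M.pathLaw μ₀ (M.stationary (Kernel.deterministic φ hφ))),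
      (ω n).2 = φ (ω n).1.1 := by
  have hset : MeasurableSet {e : M.Epoch | e.2 = φ e.1.1} :=
    measurableSet_eq_fun measurable_snd (hφ.comp (by fun_prop))
  cases n with
  | zero =>
    refine ae_of_ae_map (f := fun ω : ℕ → M.Epoch => ω 0) (p := fun e : M.Epoch => e.2 = φ e.1.1)
      (measurable_pi_apply 0).aemeasurable ?_
    rw [map_zero_pathLaw, initialLaw, ae_map_iff (by fun_prop) hset]
    refine (Measure.ae_compProd_iff ?_).2 (.of_forall fun s => ?_)
    · exact measurableSet_eq_fun measurable_snd (hφ.comp measurable_fst)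
    · rw [stationary, Kernel.deterministic_apply]
      exact ae_dirac_eq_self (φ _)
  | succ n =>
    refine ae_of_ae_map (f := fun ω : ℕ → M.Epoch =>
        (Preorder.frestrictLe (π := fun _ => M.Epoch) n ω, ω (n + 1)))
      (p := fun q : (Finset.Iic n → M.Epoch) × M.Epoch => q.2.2 = φ q.2.1.1) (by fun_prop) ?_
    rw [pathLaw, ← Kernel.map_frestrictLe_trajMeasure_compProd_eq_map_trajMeasure
      (X := fun _ => M.Epoch)]
    refine (Measure.ae_compProd_iff ?_).2 (.of_forall fun h => ?_)
    · exact hset.preimage measurable_snd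
    · refine (Kernel.ae_compProd_iff hset).2 (.of_forall fun o => ?_)
      rw [stationary, Kernel.comap_apply, Kernel.deterministic_apply]
      exact ae_dirac_eq_self (φ _)

end pathLaw

/-! ### Rewards along the path -/

/-- The reward of the period that starts at time `n`. -/
def reward (M : PortfolioMDP X Y d) (n : ℕ) (ω : ℕ → M.Epoch) : ℝ :=
  M.netReward (ω n).1.1 (ω n).2 (ω (n + 1)).1.2

section reward

variable [TopologicalSpace Y] {R : ℝ} (μ₀ : Measure M.State) [IsProbabilityMeasure μ₀]
  (π : M.Policy)

theorem Regular.measurable_netReward_comp (hM : M.Regular) {E : Type*} [MeasurableSpace E]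
    (f : E → (M.State × M.Action) × M.Obs) (hf : Measurable f) :
    Measurable fun e => M.netReward (f e).1.1 (f e).1.2 (f e).2.2 :=
  hM.measurable_netReward.comp hf

theorem Regular.measurable_reward (hM : M.Regular) (n : ℕ) : Measurable (M.reward n) := by
  have h : Measurable fun ω : ℕ → M.Epoch => (((ω n).1.1, (ω n).2), (ω (n + 1)).1) := by fun_prop
  exact hM.measurable_netReward_comp
    (fun ω : ℕ → M.Epoch => (((ω n).1.1, (ω n).2), (ω (n + 1)).1)) h

theorem Regular.ae_abs_reward_le (hM : M.Regular)
    (hR : ∀ s a, ∀ᵐ o ∂(M.kernel (s, a)), |M.netReward s a o.2| ≤ R)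
    (n : ℕ) : ∀ᵐ ω ∂(M.pathLaw μ₀ π), |M.reward n ω| ≤ R := by
  have hm : Measurable fun q : M.Epoch × M.Obs => M.netReward q.1.1.1 q.1.2 q.2.2 :=
    hM.measurable_netReward_comp (fun q : M.Epoch × M.Obs => ((q.1.1.1, q.1.2), q.2)) (by fun_prop)
  have h := ae_pathLaw_obs_succ μ₀ π n (p := fun q => |M.netReward q.1.1.1 q.1.2 q.2.2| ≤ R)
    (measurableSet_le hm.abs measurable_const) fun e => hR e.1.1 e.2
  filter_upwards [h] with ω hω
  exact hω

theorem Regular.integrable_reward (hM : M.Regular) (n : ℕ) :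
    Integrable (M.reward n) (M.pathLaw μ₀ π) := by
  obtain ⟨R, -, hR⟩ := hM.exists_reward_bound
  exact Integrable.of_bound (hM.measurable_reward n).aestronglyMeasurable R
    (hM.ae_abs_reward_le μ₀ π hR n)

/-- The almost sure bound `γ ^ n * R` on the discounted rewards is summable, so expectation and sum
may be exchanged. -/
theorem Regular.hasSum_objective (hM : M.Regular) :
    HasSum (fun n => M.discount ^ n * ∫ ω, M.reward n ω ∂(M.pathLaw μ₀ π))
      (M.objective μ₀ π) := by
  obtain ⟨R, -, hR⟩ := hM.exists_reward_bound
  have hγ := hM.discount_nonneg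
  have hint := hM.integrable_reward μ₀ π
  have h := hasSum_integral_of_summable_integral_norm (μ := M.pathLaw μ₀ π)
    (F := fun n ω => M.discount ^ n * M.reward n ω) (fun n => (hint n).const_mul _) ?_
  · simp only [integral_const_mul] at h
    exact h
  · refine Summable.of_nonneg_of_le (fun n => integral_nonneg fun ω => norm_nonneg _) (fun n => ?_)
      ((summable_geometric_of_lt_one hγ hM.discount_lt_one).mul_right R)
    have h1 : ∀ᵐ ω ∂(M.pathLaw μ₀ π), ‖M.discount ^ n * M.reward n ω‖ ≤ M.discount ^ n * R := by
      filter_upwards [hM.ae_abs_reward_le μ₀ π hR n] with ω hω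
      rw [norm_mul, Real.norm_of_nonneg (pow_nonneg hγ n)]
      exact mul_le_mul_of_nonneg_left hω (pow_nonneg hγ n)
    have h2 := integral_mono_ae ((hint n).const_mul _).norm (integrable_const _) h1
    simpa using h2

variable {V : M.State → ℝ} {B : ℝ}

/-- Conditioning on the epoch at time `n` turns reward plus discounted continuation into `bellman
V`, whatever the policy. This is the step that verification telescopes. -/
theorem Regular.integral_reward_add (hM : M.Regular) (hV : Measurable V)
    (hVB : ∀ s, |V s| ≤ B) (n : ℕ) :
    ∫ ω, M.reward n ω ∂(M.pathLaw μ₀ π)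
        + M.discount * ∫ ω, V (ω (n + 1)).1.1 ∂(M.pathLaw μ₀ π)
      = ∫ ω, M.bellman V (ω n).1.1 (ω n).2 ∂(M.pathLaw μ₀ π) := by
  have hVi : Integrable (fun ω : ℕ → M.Epoch => V (ω (n + 1)).1.1) (M.pathLaw μ₀ π) :=
    Integrable.of_bound (hV.comp (by fun_prop)).aestronglyMeasurable B (.of_forall fun _ => hVB _)
  have hri := hM.integrable_reward μ₀ π n
  rw [← integral_const_mul, ← integral_add hri (hVi.const_mul _)]
  refine integral_pathLaw_obs_succ n
    (f := fun q => M.netReward q.1.1.1 q.1.2 q.2.2 + M.discount * V q.2.1) ?_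
    (hri.add (hVi.const_mul _))
  exact (hM.measurable_netReward_comp
    (fun q : M.Epoch × M.Obs => ((q.1.1.1, q.1.2), q.2)) (by fun_prop)).add
      ((hV.comp (by fun_prop)).const_mul _)

theorem Regular.measurable_bellman (hM : M.Regular) (hV : Measurable V) :
    Measurable fun p : M.State × M.Action => M.bellman V p.1 p.2 :=
  measurable_rewardBellman (r := M.regimeReward)
    (fun z => (hM.upperSemicontinuous_regimeReward z).measurable) hV

theorem Regular.abs_bellman_le (hM : M.Regular)
    (hR : ∀ s a, ∀ᵐ o ∂(M.kernel (s, a)), |M.netReward s a o.2| ≤ R)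
    (hVB : ∀ s, |V s| ≤ B) (s : M.State) (a : M.Action) :
    |M.bellman V s a| ≤ R + M.discount * B := by
  have := norm_integral_le_of_norm_le_const (μ := M.kernel (s, a))
    (f := fun o => M.netReward s a o.2 + M.discount * V o.1) (C := R + M.discount * B) <| by
      filter_upwards [hR s a] with o ho
      refine (abs_add_le _ _).trans (add_le_add ho ?_)
      rw [abs_mul, abs_of_nonneg hM.discount_nonneg]
      exact mul_le_mul_of_nonneg_left (hVB _) hM.discount_nonneg
  simpa [bellman] using this

theorem Regular.integrable_bellman_pathLaw (hM : M.Regular) (hV : Measurable V)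
    (hVB : ∀ s, |V s| ≤ B) (n : ℕ) :
    Integrable (fun ω : ℕ → M.Epoch => M.bellman V (ω n).1.1 (ω n).2) (M.pathLaw μ₀ π) := by
  obtain ⟨R, -, hR⟩ := hM.exists_reward_bound
  refine Integrable.of_bound (C := R + M.discount * B) ?_
    (.of_forall fun ω => hM.abs_bellman_le hR hVB _ _)
  exact ((hM.measurable_bellman hV).comp
    (f := fun ω : ℕ → M.Epoch => ((ω n).1.1, (ω n).2)) (by fun_prop)).aestronglyMeasurable

end reward

end PortfolioMDP

/-! ### Verification and optimality -/

/-- If `e n + γ v (n + 1) ≤ v n` for a bounded sequence `v`, then `∑ γ ^ n e n ≤ v 0`. -/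
theorem le_of_hasSum_of_add_mul_succ_le {γ : ℝ} (hγ : 0 ≤ γ) (hγ1 : γ < 1) {e v : ℕ → ℝ} {B J : ℝ}
    (hv : ∀ n, |v n| ≤ B) (hJ : HasSum (fun n => γ ^ n * e n) J)
    (h : ∀ n, e n + γ * v (n + 1) ≤ v n) : J ≤ v 0 := by
  -- Weighting the hypothesis by `γ ^ n` makes it telescope; the remainder `γ ^ N * v N` vanishes
  -- because `v` is bounded.
  have hpart : ∀ N, ∑ n ∈ Finset.range N, γ ^ n * e n ≤ v 0 - γ ^ N * v N := fun N => by
    induction N with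
    | zero => simp
    | succ N ih =>
      rw [Finset.sum_range_succ, pow_succ]
      have := mul_le_mul_of_nonneg_left (h N) (pow_nonneg hγ N)
      linarith
  have hzero : Tendsto (fun N => γ ^ N * v N) atTop (𝓝 0) := by
    refine squeeze_zero_norm (a := fun N => γ ^ N * B) (fun N => ?_) ?_
    · rw [norm_mul, Real.norm_of_nonneg (pow_nonneg hγ N)]
      exact mul_le_mul_of_nonneg_left (hv N) (pow_nonneg hγ N)
    · simpa using (tendsto_pow_atTop_nhds_zero_of_lt_one hγ hγ1).mul_const B
  have := le_of_tendsto_of_tendsto' hJ.tendsto_sum_nat (tendsto_const_nhds.sub hzero) hpart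
  simpa using this

namespace PortfolioMDP

variable {X Y : Type*} [MeasurableSpace X] [MeasurableSpace Y] {d : ℕ} {M : PortfolioMDP X Y d}

theorem abs_integral_comp_le {Ω : Type*} [MeasurableSpace Ω] (μ : Measure Ω)
    [IsProbabilityMeasure μ] {f : Ω → ℝ} {B : ℝ} (hf : ∀ ω, |f ω| ≤ B) : |∫ ω, f ω ∂μ| ≤ B := by
  simpa using norm_integral_le_of_norm_le_const (μ := μ) (f := f) (.of_forall hf)

theorem integral_state_zero {V : M.State → ℝ} (hV : Measurable V) (μ₀ : Measure M.State)
    [IsProbabilityMeasure μ₀] (π : M.Policy) :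
    ∫ ω, V (ω 0).1.1 ∂(M.pathLaw μ₀ π) = ∫ s, V s ∂μ₀ := by
  conv_rhs => rw [← map_state_zero_pathLaw μ₀ π]
  have h : Measurable fun ω : ℕ → M.Epoch => (ω 0).1.1 := by fun_prop
  rw [integral_map h.aemeasurable hV.aestronglyMeasurable]

section verification

variable [TopologicalSpace Y] {V : M.State → ℝ} {B : ℝ}

/-- A supersolution of the optimality equation bounds the objective of every policy. -/
theorem Regular.objective_le_integral (hM : M.Regular) (hV : Measurable V) (hVB : ∀ s, |V s| ≤ B)
    (hle : ∀ s a, M.bellman V s a ≤ V s) (μ₀ : Measure M.State) [IsProbabilityMeasure μ₀]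
    (π : M.Policy) : M.objective μ₀ π ≤ ∫ s, V s ∂μ₀ := by
  rw [← integral_state_zero hV μ₀ π]
  refine le_of_hasSum_of_add_mul_succ_le (v := fun n => ∫ ω, V (ω n).1.1 ∂(M.pathLaw μ₀ π))
    hM.discount_nonneg hM.discount_lt_one (fun n => abs_integral_comp_le _ fun ω => hVB _)
    (hM.hasSum_objective μ₀ π) fun n => ?_
  rw [hM.integral_reward_add μ₀ π hV hVB n]
  exact integral_mono (hM.integrable_bellman_pathLaw μ₀ π hV hVB n)
    (Integrable.of_bound (hV.comp (by fun_prop)).aestronglyMeasurable B (.of_forall fun _ => hVB _))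
    fun ω => hle _ _

/-- A stationary policy attains `V` if its actions satisfy the optimality equation. -/
theorem Regular.integral_le_objective (hM : M.Regular) (hV : Measurable V) (hVB : ∀ s, |V s| ≤ B)
    {φ : M.State → M.Action} (hφ : Measurable φ) (heq : ∀ s, M.bellman V s (φ s) = V s)
    (μ₀ : Measure M.State) [IsProbabilityMeasure μ₀] :
    ∫ s, V s ∂μ₀ ≤ M.objective μ₀ (M.stationary (Kernel.deterministic φ hφ)) := by
  set π := M.stationary (Kernel.deterministic φ hφ)
  -- Along `φ` the one-step relation is an equality, so the same telescoping lemma applied to the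
  -- negated sequences gives the reverse bound.
  rw [← integral_state_zero hV μ₀ π, ← neg_le_neg_iff]
  refine le_of_hasSum_of_add_mul_succ_le (B := B)
    (e := fun n => -∫ ω, M.reward n ω ∂(M.pathLaw μ₀ π))
    (v := fun n => -∫ ω, V (ω n).1.1 ∂(M.pathLaw μ₀ π))
    hM.discount_nonneg hM.discount_lt_one
    (fun n => by rw [abs_neg]; exact abs_integral_comp_le _ fun ω => hVB _)
    (by simpa only [mul_neg] using (hM.hasSum_objective μ₀ π).neg) fun n => ?_
  have h1 := hM.integral_reward_add μ₀ π hV hVB n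
  have h2 : ∫ ω, M.bellman V (ω n).1.1 (ω n).2 ∂(M.pathLaw μ₀ π)
      = ∫ ω, V (ω n).1.1 ∂(M.pathLaw μ₀ π) := by
    refine integral_congr_ae ?_
    filter_upwards [ae_pathLaw_stationary_deterministic μ₀ hφ n] with ω hω
    rw [hω, heq]
  linarith

end verification

end PortfolioMDP

end

theorem mainTheorem2 {X Y : Type*} [MeasurableSpace X] [StandardBorelSpace X]
    [TopologicalSpace Y] [PolishSpace Y] [MeasurableSpace Y] [BorelSpace Y] {d : ℕ}
    (M : PortfolioMDP X Y d) (hM : M.Regular) :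
    ∃ (φ : M.State → M.Action) (hφ : Measurable φ),
      M.IsOptimal (M.stationary (Kernel.deterministic φ hφ)) ∧
      ∀ (s : M.State) (a : M.Action),
        M.actionValue (M.stationary (Kernel.deterministic φ hφ)) s a ≤
          M.actionValue (M.stationary (Kernel.deterministic φ hφ)) s (φ s) := by
  obtain ⟨V, φ, B, hV, hφ, hVB, hle, heq⟩ := hM.exists_optimality_equation
  refine ⟨φ, hφ, fun μ₀ _ π' => (hM.objective_le_integral hV hVB hle μ₀ π').trans
    (hM.integral_le_objective hV hVB hφ heq μ₀), ?_⟩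
  -- Both verification bounds at a Dirac initial law identify `V` pointwise as the value of the
  -- policy, so maximizing `bellman V` is maximizing its action value.
  have hval : M.value (M.stationary (Kernel.deterministic φ hφ)) = V := by
    funext s
    have h := integral_dirac' V s hV.stronglyMeasurable
    exact ((hM.objective_le_integral hV hVB hle (Measure.dirac s) _).trans_eq h).antisymm
      (h.symm.trans_le (hM.integral_le_objective hV hVB hφ heq (Measure.dirac s)))
  intro s a
  have h : ∀ a', M.actionValue (M.stationary (Kernel.deterministic φ hφ)) s a'
      = M.bellman V s a' := fun a' => by rw [PortfolioMDP.actionValue, hval, PortfolioMDP.bellman]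
  rw [h, h, heq]
  exact hle s a
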